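/- Let $(\Omega,\mathfrak A,P)$ be a probability space, let $X:\Omega\to\mathcal X$ be a random element of a measurable space $\mathcal X$ (for instance a subset of $\mathbb R^{d}$), and let $\delta,\delta^*:\mathcal X\to\{0,1\}$ be measurable functions (deterministic treatment rules). For every $\omega\in\Omega$ let $\mathcal Y_1(\omega),\mathcal Y_0(\omega)\subseteq\mathbb R$, such that $\mathcal Y_1\times\mathcal Y_0$ is a random closed set in $\mathbb R^2$: $\mathcal Y_1(\omega)\times\mathcal Y_0(\omega)$ is closed for every $\omega$, and $\{\omega:(\mathcal Y_1(\omega)\times\mathcal Y_0(\omega))\cap K\neq\emptyset\}\in\mathfrak A$ for every compact $K\subset\mathbb R^2$. A selection of $\mathcal Y_1\times\mathcal Y_0$ is a random vector $(Y_1,Y_0)$ with $(Y_1(\omega),Y_0(\omega))\in\mathcal Y_1(\omega)\times\mathcal Y_0(\omega)$ for almost every $\omega$. Assume that $\mathcal Y_1\times\mathcal Y_0$ is integrable (it has at least one selection with $E\|(Y_1,Y_0)\|<\infty$) and almost surely convex. Define the sharp identified region of the welfare gain as $$B_I(\delta,\delta^*)=\Big\{E\big[E[Y_1-Y_0\mid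 X]\,(\delta(X)-\delta^*(X))\big]:\ (Y_1,Y_0)\text{ a selection of }\mathcal Y_1\times\mathcal Y_0\text{ with }E|Y_1-Y_0|<\infty\Big\}\subseteq\mathbb R .$$ Let $s(v,K)=\sup_{x\in K}\langle v,x\rangle\in[-\infty,\infty]$ be the support function, $v^*=(1,-1)$, and $$\underline\Delta(X)=-E[s(-v^*,\mathcal Y_1\times\mathcal Y_0)\mid X],\qquad \bar\Delta(X)=E[s(v^*,\mathcal Y_1\times\mathcal Y_0)\mid X],$$ $$\theta_{10}(X)=\mathbf 1\{\delta(X)=1,\delta^*(X)=0\},\qquad \theta_{01}(X)=\mathbf 1\{\delta(X)=0,\delta^*(X)=1\},$$ $$\beta_l=E[\underline\Delta(X)\theta_{10}(X)-\bar\Delta(X)\theta_{01}(X)],\qquad \beta_u=E[\bar\Delta(X)\theta_{10}(X)-\underline\Delta(X)\theta_{01}(X)],$$ where (conditional) expectations of $[-\infty,\infty]$-valued variables are positive part minus negative part, and $0\cdot(\pm\infty)=0$. Then all these extended-valued expectations exist (in each case the positive or the negative part has finite expectation), $B_I(\delta,\delta^*)$ is nonempty, and it is the interval $[\beta_l,\beta_u]$,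 that is, $$B_I(\delta,\delta^*)=\{\beta\in\mathbb R:\ \beta_l\le\beta\le\beta_u\},$$ where $\beta_l=-\infty$ and $\beta_u=+\infty$ are possible. -/

import Mathlib

open MeasureTheory
open scoped ENNReal

noncomputable section

namespace WelfareGain

/-! ### Random closed sets in `ℝ^d` -/

/-- A map from `Ω` to the closed subsets of `ℝ^d` such that every event "the random set hits the
compact set `K`" is measurable. -/
structure IsRandomClosedSet {Ω : Type*} [MeasurableSpace Ω] {d : ℕ}
    (𝒴 : Ω → Set (EuclideanSpace ℝ (Fin d))) : Prop where
  isClosed : ∀ ω, IsClosed (𝒴 ω)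
  measurableSet_hit : ∀ K : Set (EuclideanSpace ℝ (Fin d)), IsCompact K →
    MeasurableSet {ω | (𝒴 ω ∩ K).Nonempty}

/-- Measurable selections: random vectors lying almost surely in the random set. -/
structure IsSelection {Ω : Type*} [MeasurableSpace Ω] (μ : Measure Ω) {d : ℕ}
    (𝒴 : Ω → Set (EuclideanSpace ℝ (Fin d))) (ξ : Ω → EuclideanSpace ℝ (Fin d)) : Prop where
  measurable : Measurable ξ
  mem_ae : ∀ᵐ ω ∂μ, ξ ω ∈ 𝒴 ω

/-- A random closed set is integrable if it has at least one integrable selection. -/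
structure IsIntegrableRandomSet {Ω : Type*} [MeasurableSpace Ω] (μ : Measure Ω) {d : ℕ}
    (𝒴 : Ω → Set (EuclideanSpace ℝ (Fin d))) : Prop where
  isRandomClosedSet : IsRandomClosedSet 𝒴
  exists_integrable_selection : ∃ ξ, IsSelection μ 𝒴 ξ ∧ Integrable ξ μ

/-- The support function `s(v, K) = sup_{x ∈ K} ⟨v, x⟩`, with values in `[-∞, ∞]`. -/
def supportFun {d : ℕ} (v : EuclideanSpace ℝ (Fin d)) (K : Set (EuclideanSpace ℝ (Fin d))) :
    EReal :=
  ⨆ x ∈ K, ((inner ℝ v x : ℝ) : EReal)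

/-- The product `A × B` of two subsets of the line, as a subset of the Euclidean plane. -/
def planeProd (A B : Set ℝ) : Set (EuclideanSpace ℝ (Fin 2)) :=
  {z | z 0 ∈ A ∧ z 1 ∈ B}

/-- The direction `v* = (1, -1)`. -/
def vStar : EuclideanSpace ℝ (Fin 2) := !₂[1, -1]

/-! ### Expectations of random variables with values in `[-∞, ∞]` -/

/-- The expectation of `f` exists in `[-∞, ∞]`: `f` is measurable (up to a null set), and its
positive part or its negative part has a finite expectation. -/
def HasExpectation {Ω : Type*} [MeasurableSpace Ω] (μ : Measure Ω) (f : Ω → EReal) : Prop :=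
  AEMeasurable f μ ∧
    ((∫⁻ ω, (f ω).toENNReal ∂μ) ≠ ⊤ ∨ (∫⁻ ω, (-f ω).toENNReal ∂μ) ≠ ⊤)

/-- The expectation `E[f] = E[f⁺] - E[f⁻]` in `[-∞, ∞]`; meaningful under `HasExpectation`. -/
def expectation {Ω : Type*} [MeasurableSpace Ω] (μ : Measure Ω) (f : Ω → EReal) : EReal :=
  ((∫⁻ ω, (f ω).toENNReal ∂μ : ℝ≥0∞) : EReal) - ((∫⁻ ω, (-f ω).toENNReal ∂μ : ℝ≥0∞) : EReal)

/-- The conditional expectation `E[f | X] = E[f⁺ | X] - E[f⁻ | X]` in `[-∞, ∞]`, as a random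
variable on `Ω`; meaningful under `HasExpectation`. -/
def condExpectation {Ω 𝒳 : Type*} [MeasurableSpace Ω] [m𝒳 : MeasurableSpace 𝒳] (μ : Measure Ω)
    (f : Ω → EReal) (X : Ω → 𝒳) (ω : Ω) : EReal :=
  (condLExp (m𝒳.comap X) μ (fun ω' => (f ω').toENNReal) ω : EReal) -
    (condLExp (m𝒳.comap X) μ (fun ω' => (-f ω').toENNReal) ω : EReal)

/-! ### Welfare gain -/

/-- `Δ̄(X) = E[s(v*, 𝒴₁ × 𝒴₀) | X]`. -/
def cateUpper {Ω 𝒳 : Type*} [MeasurableSpace Ω] [MeasurableSpace 𝒳] (μ : Measure Ω)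
    (𝒴₁ 𝒴₀ : Ω → Set ℝ) (X : Ω → 𝒳) (ω : Ω) : EReal :=
  condExpectation μ (fun ω' => supportFun vStar (planeProd (𝒴₁ ω') (𝒴₀ ω'))) X ω

/-- `Δ̲(X) = -E[s(-v*, 𝒴₁ × 𝒴₀) | X]`. -/
def cateLower {Ω 𝒳 : Type*} [MeasurableSpace Ω] [MeasurableSpace 𝒳] (μ : Measure Ω)
    (𝒴₁ 𝒴₀ : Ω → Set ℝ) (X : Ω → 𝒳) (ω : Ω) : EReal :=
  -condExpectation μ (fun ω' => supportFun (-vStar) (planeProd (𝒴₁ ω') (𝒴₀ ω'))) X ω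

/-- `θ₁₀(x) = 1{δ(x) = 1, δ*(x) = 0}`. -/
def theta10 {𝒳 : Type*} (δ δs : 𝒳 → ({0, 1} : Set ℝ)) : 𝒳 → EReal :=
  Set.indicator {x | (δ x : ℝ) = 1 ∧ (δs x : ℝ) = 0} 1

/-- `θ₀₁(x) = 1{δ(x) = 0, δ*(x) = 1}`. -/
def theta01 {𝒳 : Type*} (δ δs : 𝒳 → ({0, 1} : Set ℝ)) : 𝒳 → EReal :=
  Set.indicator {x | (δ x : ℝ) = 0 ∧ (δs x : ℝ) = 1} 1

/-- The random variable `Δ̲(X) θ₁₀(X) - Δ̄(X) θ₀₁(X)`. -/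
def lowerGain {Ω 𝒳 : Type*} [MeasurableSpace Ω] [MeasurableSpace 𝒳] (μ : Measure Ω)
    (𝒴₁ 𝒴₀ : Ω → Set ℝ) (X : Ω → 𝒳) (δ δs : 𝒳 → ({0, 1} : Set ℝ)) (ω : Ω) : EReal :=
  cateLower μ 𝒴₁ 𝒴₀ X ω * theta10 δ δs (X ω) - cateUpper μ 𝒴₁ 𝒴₀ X ω * theta01 δ δs (X ω)

/-- The random variable `Δ̄(X) θ₁₀(X) - Δ̲(X) θ₀₁(X)`. -/
def upperGain {Ω 𝒳 : Type*} [MeasurableSpace Ω] [MeasurableSpace 𝒳] (μ : Measure Ω)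
    (𝒴₁ 𝒴₀ : Ω → Set ℝ) (X : Ω → 𝒳) (δ δs : 𝒳 → ({0, 1} : Set ℝ)) (ω : Ω) : EReal :=
  cateUpper μ 𝒴₁ 𝒴₀ X ω * theta10 δ δs (X ω) - cateLower μ 𝒴₁ 𝒴₀ X ω * theta01 δ δs (X ω)

/-- The sharp identified region: all values `E[E[Y₁ - Y₀ | X] (δ(X) - δ*(X))]`, where `(Y₁, Y₀)`
is a selection of `𝒴₁ × 𝒴₀` for which `E[Y₁ - Y₀ | X]` is defined, i.e. `Y₁ - Y₀` is
integrable. -/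
def identifiedRegion {Ω 𝒳 : Type*} [MeasurableSpace Ω] [m𝒳 : MeasurableSpace 𝒳] (μ : Measure Ω)
    (𝒴₁ 𝒴₀ : Ω → Set ℝ) (X : Ω → 𝒳) (δ δs : 𝒳 → ({0, 1} : Set ℝ)) : Set ℝ :=
  {β | ∃ Y : Ω → EuclideanSpace ℝ (Fin 2),
    IsSelection μ (fun ω => planeProd (𝒴₁ ω) (𝒴₀ ω)) Y ∧
    Integrable (fun ω => Y ω 0 - Y ω 1) μ ∧
    β = ∫ ω, (condExp (m𝒳.comap X) μ (fun ω' => Y ω' 0 - Y ω' 1)) ω *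
      ((δ (X ω) : ℝ) - (δs (X ω) : ℝ)) ∂μ}

end WelfareGain

end

namespace WelfareGain

/-! ### Support functions -/

/-! Write `D = Y₁ - Y₀` and `g = δ(X) - δ*(X) ∈ {-1, 0, 1}`. Since `g` is a bounded function of `X`,
conditioning drops out of both sides: `E[E[D | X] g] = E[D g]`, and the upper bound equals `E[G]`,
where `G` (`pointwiseGain`) is `s(v*, ·)` where `g = 1`, `s(-v*, ·)` where `g = -1`, and `0`
elsewhere. The negative part of `G` is integrable thanks to the integrable selection, so no `∞ - ∞`
spoils this. As `D g ≤ G` almost surely, the upper bound holds.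

Conversely, let `β` lie between an attained value `E[D g]` and `E[G]`. Some integrable `h` with `D g
≤ h ≤ G` a.s. has integral `β` (`exists_integrable_between`). Changing `D` where `g ≠ 0` gives an
integrable `c` with `c g = h` and `-s(-v*, ·) ≤ c ≤ s(v*, ·)`, and convexity yields a selection
whose difference is exactly `c` (`exists_isSelection_sub_eq`).

Exchanging the two rules negates the region and swaps its ends, so only the upward direction needs
proof. -/

theorem inner_le_supportFun {d : ℕ} (v : EuclideanSpace ℝ (Fin d))
    {K : Set (EuclideanSpace ℝ (Fin d))} {x : EuclideanSpace ℝ (Fin d)} (hx : x ∈ K) :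
    ((inner ℝ v x : ℝ) : EReal) ≤ supportFun v K :=
  le_iSup₂ (f := fun (x : EuclideanSpace ℝ (Fin d)) (_ : x ∈ K) => ((inner ℝ v x : ℝ) : EReal)) x hx

theorem supportFun_le {d : ℕ} {v : EuclideanSpace ℝ (Fin d)}
    {K : Set (EuclideanSpace ℝ (Fin d))} {u : ℝ} (h : ∀ x ∈ K, inner ℝ v x ≤ u) :
    supportFun v K ≤ u :=
  iSup₂_le fun x hx => EReal.coe_le_coe_iff.2 (h x hx)

/-- The supremum exceeds `c` iff, for some rational `q > c`, the set meets the half-space `{q ≤ ⟨v,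
x⟩}`. Intersecting with balls of integer radius makes this a countable union of hitting events for
compact sets. -/
theorem measurable_supportFun {Ω : Type*} [MeasurableSpace Ω] {d : ℕ}
    {𝒴 : Ω → Set (EuclideanSpace ℝ (Fin d))} (h : IsRandomClosedSet 𝒴)
    (v : EuclideanSpace ℝ (Fin d)) : Measurable fun ω => supportFun v (𝒴 ω) := by
  refine measurable_of_Ioi fun c => ?_
  have key : (fun ω => supportFun v (𝒴 ω)) ⁻¹' Set.Ioi c =
      ⋃ (q : ℚ) (_ : c < ((q : ℝ) : EReal)) (n : ℕ),
        {ω | (𝒴 ω ∩ (Metric.closedBall 0 n ∩ {x | (q : ℝ) ≤ inner ℝ v x})).Nonempty} := by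
    ext ω
    simp only [Set.mem_preimage, Set.mem_Ioi, Set.mem_iUnion, Set.mem_ofPred_eq, exists_prop]
    constructor
    · intro hc
      obtain ⟨x, hx, hcx⟩ : ∃ x ∈ 𝒴 ω, c < ((inner ℝ v x : ℝ) : EReal) := by
        simpa [supportFun, lt_iSup_iff] using hc
      obtain ⟨q, hq, hqx⟩ := EReal.lt_iff_exists_rat_btwn.1 hcx
      obtain ⟨n, hn⟩ := exists_nat_ge ‖x‖
      exact ⟨q, hq, n, x, hx, by simpa using hn, (EReal.coe_lt_coe_iff.1 hqx).le⟩
    · rintro ⟨q, hq, n, x, hx, -, hqx⟩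
      exact hq.trans_le ((EReal.coe_le_coe_iff.2 hqx).trans (inner_le_supportFun v hx))
  rw [key]
  refine MeasurableSet.iUnion fun q => MeasurableSet.iUnion fun _ => MeasurableSet.iUnion fun n =>
    h.measurableSet_hit _ ((isCompact_closedBall _ _).inter_right ?_)
  exact isClosed_le continuous_const (by fun_prop)

theorem inner_vStar (z : EuclideanSpace ℝ (Fin 2)) : inner ℝ vStar z = z 0 - z 1 := by
  simp [vStar, PiLp.inner_apply, Fin.sum_univ_two]; ring

theorem coe_sub_le_supportFun_vStar {A B : Set ℝ} {z : EuclideanSpace ℝ (Fin 2)}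
    (hz : z ∈ planeProd A B) : ((z 0 - z 1 : ℝ) : EReal) ≤ supportFun vStar (planeProd A B) := by
  simpa only [inner_vStar] using inner_le_supportFun vStar hz

theorem coe_sub_le_supportFun_neg_vStar {A B : Set ℝ} {z : EuclideanSpace ℝ (Fin 2)}
    (hz : z ∈ planeProd A B) : ((z 1 - z 0 : ℝ) : EReal) ≤ supportFun (-vStar) (planeProd A B) := by
  simpa only [inner_neg_left, inner_vStar, neg_sub] using inner_le_supportFun (-vStar) hz

/-! ### Projecting onto a closed interval -/

/-- A point of the other factor is needed: an empty factor makes the product empty and hides the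
shape of `A`. The slice through `b` then recovers `A`. -/
theorem isClosed_fst_of_planeProd {A B : Set ℝ} {b : ℝ} (hb : b ∈ B)
    (h : IsClosed (planeProd A B)) : IsClosed A := by
  have hc : Continuous fun x : ℝ => (!₂[x, b] : EuclideanSpace ℝ (Fin 2)) := by fun_prop
  have : A = (fun x : ℝ => (!₂[x, b] : EuclideanSpace ℝ (Fin 2))) ⁻¹' planeProd A B := by
    ext x; simp [planeProd, hb]
  rw [this]
  exact h.preimage hc

theorem isClosed_snd_of_planeProd {A B : Set ℝ} {a : ℝ} (ha : a ∈ A)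
    (h : IsClosed (planeProd A B)) : IsClosed B := by
  have hc : Continuous fun x : ℝ => (!₂[a, x] : EuclideanSpace ℝ (Fin 2)) := by fun_prop
  have : B = (fun x : ℝ => (!₂[a, x] : EuclideanSpace ℝ (Fin 2))) ⁻¹' planeProd A B := by
    ext x; simp [planeProd, ha]
  rw [this]
  exact h.preimage hc

theorem ordConnected_fst_of_planeProd {A B : Set ℝ} {b : ℝ} (hb : b ∈ B)
    (h : Convex ℝ (planeProd A B)) : A.OrdConnected := by
  refine Convex.ordConnected fun x hx y hy s t hs ht hst => ?_
  have hx' : (!₂[x, b] : EuclideanSpace ℝ (Fin 2)) ∈ planeProd A B := by simp [planeProd, hx, hb]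
  have hy' : (!₂[y, b] : EuclideanSpace ℝ (Fin 2)) ∈ planeProd A B := by simp [planeProd, hy, hb]
  simpa using (h hx' hy' hs ht hst).1

theorem ordConnected_snd_of_planeProd {A B : Set ℝ} {a : ℝ} (ha : a ∈ A)
    (h : Convex ℝ (planeProd A B)) : B.OrdConnected := by
  refine Convex.ordConnected fun x hx y hy s t hs ht hst => ?_
  have hx' : (!₂[a, x] : EuclideanSpace ℝ (Fin 2)) ∈ planeProd A B := by simp [planeProd, hx, ha]
  have hy' : (!₂[a, y] : EuclideanSpace ℝ (Fin 2)) ∈ planeProd A B := by simp [planeProd, hy, ha]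
  simpa using (h hx' hy' hs ht hst).2

/-- Truncating `w` at the infimum and the supremum of a closed interval `A` projects `w` to `A`. -/
theorem truncation_mem {A : Set ℝ} (hA : IsClosed A) (hA' : A.OrdConnected) (hne : A.Nonempty)
    {lo up : EReal} (hlo : ∀ x ∈ A, lo ≤ x) (hlo' : ∀ u : ℝ, (∀ x ∈ A, u ≤ x) → u ≤ lo)
    (hup : ∀ x ∈ A, (x : EReal) ≤ up) (hup' : ∀ u : ℝ, (∀ x ∈ A, x ≤ u) → up ≤ u) (w : ℝ) :
    (max lo (min up w)).toReal ∈ A ∧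
      ((max lo (min up w)).toReal = w ∨
        ((max lo (min up w)).toReal < w ∧ ∀ x ∈ A, x ≤ (max lo (min up w)).toReal) ∨
        (w < (max lo (min up w)).toReal ∧ ∀ x ∈ A, (max lo (min up w)).toReal ≤ x)) := by
  obtain ⟨a, ha⟩ := hne
  by_cases hw : w ∈ A
  · rw [min_eq_right (hup w hw), max_eq_right (hlo w hw), EReal.toReal_coe]
    exact ⟨hw, Or.inl rfl⟩
  -- Being outside the interval, `w` has all of `A` on one side. Thus `A` is bounded towards `w`,
  -- and by closedness it contains its endpoint there; the other endpoint may be infinite.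
  rcases le_total a w with haw | hwa
  · have hlt : ∀ x ∈ A, x < w := fun x hx => by
      by_contra! hxw
      exact hw (hA'.out ha hx ⟨haw, hxw⟩)
    have hbdd : BddAbove A := ⟨w, fun x hx => (hlt x hx).le⟩
    have hm := hA.csSup_mem ⟨a, ha⟩ hbdd
    have hmax : ∀ x ∈ A, x ≤ sSup A := fun x hx => le_csSup hbdd hx
    have hupe : up = (sSup A : ℝ) := le_antisymm (hup' _ hmax) (hup _ hm)
    rw [hupe, min_eq_left (EReal.coe_le_coe_iff.2 (hlt _ hm).le), max_eq_right (hlo _ hm),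
      EReal.toReal_coe]
    exact ⟨hm, Or.inr (Or.inl ⟨hlt _ hm, hmax⟩)⟩
  · have hlt : ∀ x ∈ A, w < x := fun x hx => by
      by_contra! hxw
      exact hw (hA'.out hx ha ⟨hxw, hwa⟩)
    have hbdd : BddBelow A := ⟨w, fun x hx => (hlt x hx).le⟩
    have hm := hA.csInf_mem ⟨a, ha⟩ hbdd
    have hmin : ∀ x ∈ A, sInf A ≤ x := fun x hx => csInf_le hbdd hx
    have hloe : lo = (sInf A : ℝ) := le_antisymm (hlo _ hm) (hlo' _ hmin)
    rw [hloe, min_eq_right ((EReal.coe_le_coe_iff.2 (hlt _ ha).le).trans (hup _ ha)),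
      max_eq_left (EReal.coe_le_coe_iff.2 (hlt _ hm).le), EReal.toReal_coe]
    exact ⟨hm, Or.inr (Or.inr ⟨hlt _ hm, hmin⟩)⟩

/-- The truncation of `w` at the infimum and the supremum of the first coordinate over `K`. -/
noncomputable def truncateFst (K : Set (EuclideanSpace ℝ (Fin 2))) (w : ℝ) : ℝ :=
  (max (-supportFun (-!₂[1, 0]) K) (min (supportFun !₂[1, 0] K) w)).toReal

theorem truncateFst_mem {A B : Set ℝ} {b : ℝ} (hb : b ∈ B) (hne : A.Nonempty)
    (hcl : IsClosed (planeProd A B)) (hconv : Convex ℝ (planeProd A B)) (w : ℝ) :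
    truncateFst (planeProd A B) w ∈ A ∧
      (truncateFst (planeProd A B) w = w ∨
        (truncateFst (planeProd A B) w < w ∧ ∀ x ∈ A, x ≤ truncateFst (planeProd A B) w) ∨
        (w < truncateFst (planeProd A B) w ∧ ∀ x ∈ A, truncateFst (planeProd A B) w ≤ x)) := by
  have hin : ∀ z : EuclideanSpace ℝ (Fin 2),
      inner ℝ (!₂[1, 0] : EuclideanSpace ℝ (Fin 2)) z = z 0 := fun z => by
    simp [PiLp.inner_apply, Fin.sum_univ_two]
  have hmem : ∀ x ∈ A, (!₂[x, b] : EuclideanSpace ℝ (Fin 2)) ∈ planeProd A B := fun x hx => by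
    simp [planeProd, hx, hb]
  refine truncation_mem (isClosed_fst_of_planeProd hb hcl) (ordConnected_fst_of_planeProd hb hconv)
    hne ?_ ?_ ?_ ?_ w
  · intro x hx
    rw [EReal.neg_le]
    simpa [hin, inner_neg_left] using inner_le_supportFun (-!₂[1, 0]) (hmem x hx)
  · intro u hu
    rw [EReal.le_neg]
    refine supportFun_le (u := -u) fun z hz => ?_
    rw [inner_neg_left, hin]
    exact neg_le_neg (hu _ hz.1)
  · intro x hx
    simpa [hin] using inner_le_supportFun !₂[1, 0] (hmem x hx)
  · intro u hu
    refine supportFun_le fun z hz => ?_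
    rw [hin]
    exact hu _ hz.1

/-- Let `p` be the projection of `c + b` to `A`. If `p = c + b`, then `p - c = b`. If `p < c + b`,
then `p = max A` and `p - c < b`; were `p - c` outside the interval `B`, it would lie below `min B`,
so `c > max A - min B`, against the bound by `s(v*, ·)`. The remaining case is symmetric and uses
`s(-v*, ·)`. -/
theorem truncateFst_sub_mem {A B : Set ℝ} {b c : ℝ} (hb : b ∈ B) (hne : A.Nonempty)
    (hcl : IsClosed (planeProd A B)) (hconv : Convex ℝ (planeProd A B))
    (hup : (c : EReal) ≤ supportFun vStar (planeProd A B))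
    (hlo : ((-c : ℝ) : EReal) ≤ supportFun (-vStar) (planeProd A B)) :
    truncateFst (planeProd A B) (c + b) - c ∈ B := by
  obtain ⟨hp, hcase⟩ := truncateFst_mem hb hne hcl hconv (c + b)
  set p := truncateFst (planeProd A B) (c + b)
  have hB := isClosed_snd_of_planeProd hp hcl
  have hB' := ordConnected_snd_of_planeProd hp hconv
  rcases hcase with h | ⟨hlt, hmax⟩ | ⟨hlt, hmin⟩
  · rw [h, add_sub_cancel_left]; exact hb
  · by_contra hnot
    have hgt : ∀ y ∈ B, p - c < y := fun y hy => by
      by_contra! hy'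
      exact hnot (hB'.out hy hb ⟨hy', by linarith⟩)
    have hbdd : BddBelow B := ⟨p - c, fun y hy => (hgt y hy).le⟩
    have hm := hgt _ (hB.csInf_mem ⟨b, hb⟩ hbdd)
    have : supportFun vStar (planeProd A B) ≤ ((p - sInf B : ℝ) : EReal) :=
      supportFun_le fun z hz => by
        rw [inner_vStar]
        exact sub_le_sub (hmax _ hz.1) (csInf_le hbdd hz.2)
    have := EReal.coe_le_coe_iff.1 (hup.trans this)
    linarith
  · by_contra hnot
    have hgt : ∀ y ∈ B, y < p - c := fun y hy => by
      by_contra! hy'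
      exact hnot (hB'.out hb hy ⟨by linarith, hy'⟩)
    have hbdd : BddAbove B := ⟨p - c, fun y hy => (hgt y hy).le⟩
    have hm := hgt _ (hB.csSup_mem ⟨b, hb⟩ hbdd)
    have : supportFun (-vStar) (planeProd A B) ≤ ((sSup B - p : ℝ) : EReal) :=
      supportFun_le fun z hz => by
        rw [inner_neg_left, inner_vStar, neg_sub]
        exact sub_le_sub (le_csSup hbdd hz.2) (hmin _ hz.1)
    have := EReal.coe_le_coe_iff.1 (hlo.trans this)
    linarith

/-! ### Selections with a prescribed difference -/

/-- The selection comes from an explicit formula: project `c + ξ₀`, with `ξ₀` the second coordinate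
of `ξ`, to `𝒴₁`, then subtract `c`. The projection is built from support functions, which makes it
measurable. -/
theorem exists_isSelection_sub_eq {Ω : Type*} [MeasurableSpace Ω] {μ : Measure Ω}
    {𝒴₁ 𝒴₀ : Ω → Set ℝ} (hcl : IsRandomClosedSet fun ω => planeProd (𝒴₁ ω) (𝒴₀ ω))
    (hconv : ∀ᵐ ω ∂μ, Convex ℝ (planeProd (𝒴₁ ω) (𝒴₀ ω)))
    {ξ : Ω → EuclideanSpace ℝ (Fin 2)}
    (hξ : IsSelection μ (fun ω => planeProd (𝒴₁ ω) (𝒴₀ ω)) ξ) {c : Ω → ℝ} (hc : Measurable c)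
    (hup : ∀ᵐ ω ∂μ, (c ω : EReal) ≤ supportFun vStar (planeProd (𝒴₁ ω) (𝒴₀ ω)))
    (hlo : ∀ᵐ ω ∂μ, ((-c ω : ℝ) : EReal) ≤ supportFun (-vStar) (planeProd (𝒴₁ ω) (𝒴₀ ω))) :
    ∃ Y, IsSelection μ (fun ω => planeProd (𝒴₁ ω) (𝒴₀ ω)) Y ∧ ∀ ω, Y ω 0 - Y ω 1 = c ω := by
  have hξ1 : Measurable fun ω => ξ ω 1 := by
    have := hξ.measurable
    fun_prop
  have hp : Measurable fun ω => truncateFst (planeProd (𝒴₁ ω) (𝒴₀ ω)) (c ω + ξ ω 1) := by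
    refine Measurable.ereal_toReal (Measurable.max ?_ (Measurable.min ?_ ?_))
    · exact continuous_neg.measurable.comp (measurable_supportFun hcl _)
    · exact measurable_supportFun hcl _
    · exact (hc.add hξ1).coe_real_ereal
  refine ⟨fun ω => !₂[truncateFst (planeProd (𝒴₁ ω) (𝒴₀ ω)) (c ω + ξ ω 1),
    truncateFst (planeProd (𝒴₁ ω) (𝒴₀ ω)) (c ω + ξ ω 1) - c ω], ⟨?_, ?_⟩, fun ω => by simp⟩
  · refine (WithLp.measurable_toLp 2 _).comp (measurable_pi_iff.2 fun i => ?_)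
    fin_cases i
    · exact hp
    · exact hp.sub hc
  · filter_upwards [hconv, hξ.mem_ae, hup, hlo] with ω h1 h2 h3 h4
    have hne : (𝒴₁ ω).Nonempty := ⟨_, h2.1⟩
    have hcl' := hcl.isClosed ω
    refine ⟨?_, ?_⟩
    · simpa using (truncateFst_mem h2.2 hne hcl' h1 _).1
    · simpa using truncateFst_sub_mem h2.2 hne hcl' h1 h3 h4

/-! ### Extended-valued expectations -/

section Expectation

variable {Ω : Type*} [MeasurableSpace Ω] {μ : Measure Ω}

theorem expectation_mono_ae {f g : Ω → EReal} (h : ∀ᵐ ω ∂μ, f ω ≤ g ω) :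
    expectation μ f ≤ expectation μ g := by
  refine EReal.sub_le_sub ?_ ?_ <;> rw [EReal.coe_ennreal_le_coe_ennreal_iff]
  · exact lintegral_mono_ae (h.mono fun ω hω => EReal.toENNReal_le_toENNReal hω)
  · exact lintegral_mono_ae (h.mono fun ω hω =>
      EReal.toENNReal_le_toENNReal (EReal.neg_le_neg_iff.2 hω))

theorem lintegral_neg_ne_top_of_coe_le {f : Ω → EReal} {u : Ω → ℝ} (hu : Integrable u μ)
    (h : ∀ᵐ ω ∂μ, (u ω : EReal) ≤ f ω) : ∫⁻ ω, (-f ω).toENNReal ∂μ ≠ ⊤ := by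
  refine ne_top_of_le_ne_top (hu.neg.lintegral_lt_top).ne
    (lintegral_mono_ae (h.mono fun ω hω => ?_))
  exact EReal.toENNReal_le_toENNReal (EReal.neg_le_neg_iff.2 hω)

theorem expectation_coe {u : Ω → ℝ} (hu : Integrable u μ) :
    expectation μ (fun ω => (u ω : EReal)) = ((∫ ω, u ω ∂μ : ℝ) : EReal) := by
  have h1 : ∫⁻ ω, ENNReal.ofReal (u ω) ∂μ ≠ ⊤ := hu.lintegral_lt_top.ne
  have h2 : ∫⁻ ω, ENNReal.ofReal (-u ω) ∂μ ≠ ⊤ := hu.neg.lintegral_lt_top.ne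
  rw [integral_eq_lintegral_pos_part_sub_lintegral_neg_part hu, EReal.coe_sub,
    EReal.coe_ennreal_toReal h1, EReal.coe_ennreal_toReal h2]
  rfl

theorem coe_toENNReal_sub_coe_toENNReal_neg (x : EReal) :
    (x.toENNReal : EReal) - ((-x).toENNReal : EReal) = x := by
  rcases le_total 0 x with h | h
  · have h' : -x ≤ 0 := by simpa using h
    simp [EReal.coe_toENNReal h, EReal.toENNReal_of_nonpos h']
  · have h' : 0 ≤ -x := by simpa using h
    rw [EReal.coe_toENNReal h', EReal.toENNReal_of_nonpos h]
    simp

/-- Finiteness of `y` rules out `⊤ - ⊤`, which is `⊥` in `EReal` and not stable under negation. -/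
theorem neg_coe_ennreal_sub {x y : ℝ≥0∞} (hy : y ≠ ⊤) : -((x : EReal) - y) = (y : EReal) - x :=
  (EReal.neg_sub (Or.inl (EReal.coe_ennreal_ne_bot _))
    (Or.inr (by simpa using hy))).trans (by rw [add_comm, sub_eq_add_neg])

theorem toENNReal_coe_ennreal_sub (x y : ℝ≥0∞) : ((x : EReal) - y).toENNReal = x - y := by
  rw [EReal.toENNReal_sub (EReal.coe_ennreal_nonneg _), EReal.toENNReal_coe, EReal.toENNReal_coe]

theorem hasExpectation_sub {P N : Ω → ℝ≥0∞} (hP : Measurable P) (hN : Measurable N)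
    (hfin : ∫⁻ ω, N ω ∂μ ≠ ⊤) : HasExpectation μ (fun ω => (P ω : EReal) - N ω) := by
  refine ⟨(Measurable.sub ?_ ?_).aemeasurable, Or.inr ?_⟩
  · exact hP.coe_ereal_ennreal
  · exact hN.coe_ereal_ennreal
  · refine ne_top_of_le_ne_top hfin (lintegral_mono_ae ?_)
    filter_upwards [ae_lt_top hN hfin] with ω hω
    rw [neg_coe_ennreal_sub hω.ne, toENNReal_coe_ennreal_sub]
    exact tsub_le_self

/-- Here `P` and `N` may overlap, unlike a positive and a negative part. This matters because `E[f⁺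
| X]` and `E[f⁻ | X]` can both be nonzero at the same point. -/
theorem expectation_sub {P N : Ω → ℝ≥0∞} (hP : Measurable P) (hN : Measurable N)
    (hfin : ∫⁻ ω, N ω ∂μ ≠ ⊤) :
    expectation μ (fun ω => (P ω : EReal) - N ω) =
      ((∫⁻ ω, P ω ∂μ : ℝ≥0∞) : EReal) - ((∫⁻ ω, N ω ∂μ : ℝ≥0∞) : EReal) := by
  have hneg : ∫⁻ ω, (-((P ω : EReal) - N ω)).toENNReal ∂μ = ∫⁻ ω, (N ω - P ω) ∂μ := by
    refine lintegral_congr_ae ?_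
    filter_upwards [ae_lt_top hN hfin] with ω hω
    rw [neg_coe_ennreal_sub hω.ne, toENNReal_coe_ennreal_sub]
  -- Both sides are the integral of `max P N`; this form of the identity stays valid when `P` has
  -- infinite integral.
  have hsum : ∫⁻ ω, P ω ∂μ + ∫⁻ ω, (N ω - P ω) ∂μ = ∫⁻ ω, N ω ∂μ + ∫⁻ ω, (P ω - N ω) ∂μ := by
    rw [← lintegral_add_left hP, ← lintegral_add_left hN]
    simp only [add_tsub_eq_max, max_comm]
  have hfin' : ∫⁻ ω, (N ω - P ω) ∂μ ≠ ⊤ :=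
    ne_top_of_le_ne_top hfin (lintegral_mono fun ω => tsub_le_self)
  unfold expectation
  simp only [hneg, toENNReal_coe_ennreal_sub]
  generalize ∫⁻ ω, (N ω - P ω) ∂μ = n' at *
  generalize ∫⁻ ω, (P ω - N ω) ∂μ = p' at *
  generalize ∫⁻ ω, P ω ∂μ = p at *
  generalize ∫⁻ ω, N ω ∂μ = n at *
  lift n to NNReal using hfin
  lift n' to NNReal using hfin'
  induction p with
  | top =>
    have : p' = ⊤ := by simpa using hsum.symm
    simp [this, EReal.top_sub]
  | coe p =>
    have : p' ≠ ⊤ := fun h => by simp [h, ← ENNReal.coe_add] at hsum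
    lift p' to NNReal using this
    have h : (p : ℝ) + n' = n + p' := by exact_mod_cast hsum
    simp only [EReal.coe_nnreal_eq_coe_real, ← EReal.coe_sub]
    rw [EReal.coe_eq_coe_iff]
    linarith

theorem HasExpectation.neg {f : Ω → EReal} (hf : HasExpectation μ f) :
    HasExpectation μ (fun ω => -f ω) := by
  refine ⟨continuous_neg.measurable.comp_aemeasurable hf.1, ?_⟩
  simpa only [neg_neg] using hf.2.symm

theorem HasExpectation.expectation_neg {f : Ω → EReal} (hf : HasExpectation μ f) :
    expectation μ (fun ω => -f ω) = -expectation μ f := by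
  unfold expectation
  simp only [neg_neg]
  rw [EReal.neg_sub (Or.inl (EReal.coe_ennreal_ne_bot _)), add_comm, sub_eq_add_neg]
  exact hf.2.imp (by simp) (by simp)

/-- A function with large integral dominates an integrable one with prescribed integral. -/
theorem exists_measurable_le_lintegral_eq [IsFiniteMeasure μ] {K : Ω → ℝ≥0∞} (hK : Measurable K)
    {b : ℝ≥0∞} (hb : b ≠ ⊤) (hbK : b ≤ ∫⁻ ω, K ω ∂μ) :
    ∃ k : Ω → ℝ≥0∞, Measurable k ∧ (∀ ω, k ω ≤ K ω) ∧ ∫⁻ ω, k ω ∂μ = b := by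
  obtain ⟨K', hK'm, hK'le, hK'fin, hbK'⟩ : ∃ K' : Ω → ℝ≥0∞, Measurable K' ∧ (∀ ω, K' ω ≤ K ω) ∧
      ∫⁻ ω, K' ω ∂μ ≠ ⊤ ∧ b ≤ ∫⁻ ω, K' ω ∂μ := by
    -- An infinite integral is cut down by capping `K` at a large `n`: the capped integrals are
    -- finite and increase to `⊤`.
    by_cases hfin : ∫⁻ ω, K ω ∂μ = ⊤
    · have hsup : ∫⁻ ω, K ω ∂μ = ⨆ n : ℕ, ∫⁻ ω, min (K ω) n ∂μ := by
        rw [← lintegral_iSup (fun n => hK.min measurable_const)]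
        · refine lintegral_congr fun ω => ?_
          rw [← inf_iSup_eq, ENNReal.iSup_natCast, inf_top_eq]
        · exact fun m n hmn ω => min_le_min le_rfl (by exact_mod_cast hmn)
      have : b < ⨆ n : ℕ, ∫⁻ ω, min (K ω) n ∂μ := by
        rw [← hsup, hfin]; exact hb.lt_top
      obtain ⟨n, hn⟩ := lt_iSup_iff.1 this
      refine ⟨fun ω => min (K ω) n, hK.min measurable_const, fun ω => min_le_left _ _, ?_, hn.le⟩
      refine ne_top_of_le_ne_top ?_ (lintegral_mono fun ω => min_le_right (K ω) n)
      simp [ENNReal.mul_eq_top]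
    · exact ⟨K, hK, fun _ => le_rfl, hfin, hbK⟩
  -- Scaling by a factor at most `1` adjusts the integral to `b`. If the integral of `K'` vanishes,
  -- so does `b`.
  refine ⟨fun ω => b / (∫⁻ ω, K' ω ∂μ) * K' ω, hK'm.const_mul _, fun ω => ?_, ?_⟩
  · exact (mul_le_of_le_one_left' (ENNReal.div_le_of_le_mul (by simpa using hbK'))).trans (hK'le ω)
  · rw [lintegral_const_mul _ hK'm]
    by_cases h0 : ∫⁻ ω, K' ω ∂μ = 0
    · have : b = 0 := by simpa [h0] using hbK'
      simp [h0, this]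
    · exact ENNReal.div_mul_cancel h0 hK'fin

/-- The gap `G - h₀` has total mass at least `β - ∫ h₀`, possibly infinite. Adding to `h₀` a portion
of the gap with exactly that mass gives `h`. -/
theorem exists_integrable_between [IsFiniteMeasure μ] {G : Ω → EReal} (hG : Measurable G)
    {h₀ : Ω → ℝ} (hm₀ : Measurable h₀) (hi₀ : Integrable h₀ μ)
    (hle₀ : ∀ᵐ ω ∂μ, (h₀ ω : EReal) ≤ G ω) {β : ℝ} (hβ₀ : ∫ ω, h₀ ω ∂μ ≤ β)
    (hβ : (β : EReal) ≤ expectation μ G) :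
    ∃ h : Ω → ℝ, Measurable h ∧ Integrable h μ ∧ (∀ ω, h₀ ω ≤ h ω) ∧
      (∀ᵐ ω ∂μ, (h ω : EReal) ≤ G ω) ∧ ∫ ω, h ω ∂μ = β := by
  set K : Ω → ℝ≥0∞ := fun ω => (G ω - h₀ ω).toENNReal with hKdef
  have hK : Measurable K := (hG.sub hm₀.coe_real_ereal).ereal_toENNReal
  have hKcoe : ∀ᵐ ω ∂μ, (K ω : EReal) = G ω - h₀ ω := hle₀.mono fun ω hω =>
    EReal.coe_toENNReal ((EReal.sub_nonneg (Or.inr (EReal.coe_ne_top _))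
      (Or.inr (EReal.coe_ne_bot _))).2 hω)
  have hbK : ENNReal.ofReal (β - ∫ ω, h₀ ω ∂μ) ≤ ∫⁻ ω, K ω ∂μ := by
    by_cases hfin : ∫⁻ ω, K ω ∂μ = ⊤
    · simp [hfin]
    have hKi : Integrable (fun ω => (K ω).toReal) μ :=
      integrable_toReal_of_lintegral_ne_top hK.aemeasurable hfin
    have hub : expectation μ G ≤ ((∫ ω, (h₀ ω + (K ω).toReal) ∂μ : ℝ) : EReal) := by
      rw [← expectation_coe (u := fun ω => h₀ ω + (K ω).toReal) (hi₀.add hKi)]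
      refine expectation_mono_ae ?_
      filter_upwards [hKcoe, ae_lt_top hK hfin] with ω h1 h2
      rw [EReal.coe_add, EReal.coe_ennreal_toReal h2.ne, h1, add_comm, EReal.sub_add_cancel]
    have := EReal.coe_le_coe_iff.1 (hβ.trans hub)
    rw [integral_add hi₀ hKi, integral_toReal hK.aemeasurable (ae_lt_top hK hfin)] at this
    exact ENNReal.ofReal_le_of_le_toReal (by linarith)
  obtain ⟨k, hk, hkK, hkb⟩ := exists_measurable_le_lintegral_eq hK ENNReal.ofReal_ne_top hbK
  have hkfin : ∫⁻ ω, k ω ∂μ ≠ ⊤ := by rw [hkb]; exact ENNReal.ofReal_ne_top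
  have hki : Integrable (fun ω => (k ω).toReal) μ :=
    integrable_toReal_of_lintegral_ne_top hk.aemeasurable hkfin
  refine ⟨fun ω => h₀ ω + (k ω).toReal, hm₀.add hk.ennreal_toReal, hi₀.add hki,
    fun ω => by simp, ?_, ?_⟩
  · filter_upwards [hKcoe, ae_lt_top hk hkfin] with ω h1 h2
    rw [EReal.coe_add, EReal.coe_ennreal_toReal h2.ne, add_comm]
    refine (add_le_add_left (EReal.coe_ennreal_le_coe_ennreal_iff.2 (hkK ω)) _).trans ?_
    rw [h1, EReal.sub_add_cancel]
  · rw [integral_add hi₀ hki, integral_toReal hk.aemeasurable (ae_lt_top hk hkfin), hkb,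
      ENNReal.toReal_ofReal (by linarith)]
    ring

end Expectation

/-! ### Welfare gain -/

section Rules

variable {Ω 𝒳 : Type*}

/-- The covariate values at which `δ` treats and `δs` does not. -/
def treatSet (δ δs : 𝒳 → ({0, 1} : Set ℝ)) : Set 𝒳 :=
  {x | (δ x : ℝ) = 1 ∧ (δs x : ℝ) = 0}

theorem theta10_of_mem {δ δs : 𝒳 → ({0, 1} : Set ℝ)} {x : 𝒳} (h : x ∈ treatSet δ δs) :
    theta10 δ δs x = 1 := Set.indicator_of_mem (by exact h) _

theorem theta10_of_notMem {δ δs : 𝒳 → ({0, 1} : Set ℝ)} {x : 𝒳} (h : x ∉ treatSet δ δs) :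
    theta10 δ δs x = 0 := Set.indicator_of_notMem (by exact h) _

theorem theta01_eq (δ δs : 𝒳 → ({0, 1} : Set ℝ)) : theta01 δ δs = theta10 δs δ := by
  simp only [theta01, theta10, and_comm]

theorem notMem_treatSet_swap {δ δs : 𝒳 → ({0, 1} : Set ℝ)} {x : 𝒳} (h : x ∈ treatSet δ δs) :
    x ∉ treatSet δs δ := fun h' => by
  have := h.1.symm.trans h'.2
  norm_num at this

theorem eq_of_notMem_treatSet {δ δs : 𝒳 → ({0, 1} : Set ℝ)} {x : 𝒳} (h : x ∉ treatSet δ δs)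
    (h' : x ∉ treatSet δs δ) : (δ x : ℝ) = δs x := by
  have h1 : (δ x : ℝ) = 0 ∨ (δ x : ℝ) = 1 := (δ x).2
  have h2 : (δs x : ℝ) = 0 ∨ (δs x : ℝ) = 1 := (δs x).2
  rcases h1 with h1 | h1 <;> rcases h2 with h2 | h2 <;> simp_all [treatSet]

/-- The largest welfare gain before conditioning on the covariates. -/
noncomputable def pointwiseGain (𝒴₁ 𝒴₀ : Ω → Set ℝ) (X : Ω → 𝒳) (δ δs : 𝒳 → ({0, 1} : Set ℝ))
    (ω : Ω) : EReal :=
  -- The difference of nonnegative terms mirrors the conditioned gain, so that the two can be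
  -- compared term by term through `expectation_sub`.
  (((X ⁻¹' treatSet δ δs).indicator
        (fun ω => (supportFun vStar (planeProd (𝒴₁ ω) (𝒴₀ ω))).toENNReal) ω +
      (X ⁻¹' treatSet δs δ).indicator
        (fun ω => (supportFun (-vStar) (planeProd (𝒴₁ ω) (𝒴₀ ω))).toENNReal) ω : ℝ≥0∞) : EReal) -
    (((X ⁻¹' treatSet δ δs).indicator
        (fun ω => (-supportFun vStar (planeProd (𝒴₁ ω) (𝒴₀ ω))).toENNReal) ω +
      (X ⁻¹' treatSet δs δ).indicator
        (fun ω => (-supportFun (-vStar) (planeProd (𝒴₁ ω) (𝒴₀ ω))).toENNReal) ω : ℝ≥0∞) : EReal)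

theorem pointwiseGain_of_mem {𝒴₁ 𝒴₀ : Ω → Set ℝ} {X : Ω → 𝒳} {δ δs : 𝒳 → ({0, 1} : Set ℝ)}
    {ω : Ω} (h : X ω ∈ treatSet δ δs) :
    pointwiseGain 𝒴₁ 𝒴₀ X δ δs ω = supportFun vStar (planeProd (𝒴₁ ω) (𝒴₀ ω)) := by
  simp [pointwiseGain, h, notMem_treatSet_swap h, coe_toENNReal_sub_coe_toENNReal_neg]

theorem pointwiseGain_of_mem_swap {𝒴₁ 𝒴₀ : Ω → Set ℝ} {X : Ω → 𝒳}
    {δ δs : 𝒳 → ({0, 1} : Set ℝ)} {ω : Ω} (h : X ω ∈ treatSet δs δ) :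
    pointwiseGain 𝒴₁ 𝒴₀ X δ δs ω = supportFun (-vStar) (planeProd (𝒴₁ ω) (𝒴₀ ω)) := by
  simp [pointwiseGain, h, notMem_treatSet_swap h, coe_toENNReal_sub_coe_toENNReal_neg]

theorem pointwiseGain_of_notMem {𝒴₁ 𝒴₀ : Ω → Set ℝ} {X : Ω → 𝒳}
    {δ δs : 𝒳 → ({0, 1} : Set ℝ)} {ω : Ω} (h : X ω ∉ treatSet δ δs) (h' : X ω ∉ treatSet δs δ) :
    pointwiseGain 𝒴₁ 𝒴₀ X δ δs ω = 0 := by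
  simp [pointwiseGain, h, h']

theorem coe_mul_le_pointwiseGain {𝒴₁ 𝒴₀ : Ω → Set ℝ} {X : Ω → 𝒳} {δ δs : 𝒳 → ({0, 1} : Set ℝ)}
    {ω : Ω} {z : EuclideanSpace ℝ (Fin 2)} (hz : z ∈ planeProd (𝒴₁ ω) (𝒴₀ ω)) :
    (((z 0 - z 1) * ((δ (X ω) : ℝ) - δs (X ω)) : ℝ) : EReal) ≤ pointwiseGain 𝒴₁ 𝒴₀ X δ δs ω := by
  by_cases h : X ω ∈ treatSet δ δs
  · rw [pointwiseGain_of_mem h, h.1, h.2, sub_zero, mul_one]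
    exact coe_sub_le_supportFun_vStar hz
  by_cases h' : X ω ∈ treatSet δs δ
  · rw [pointwiseGain_of_mem_swap h', h'.1, h'.2, zero_sub, mul_neg_one, neg_sub]
    exact coe_sub_le_supportFun_neg_vStar hz
  · rw [pointwiseGain_of_notMem h h', eq_of_notMem_treatSet h h']
    simp

end Rules

/-! ### Expected gains and the identified region -/

section Gain

variable {Ω 𝒳 : Type*} [MeasurableSpace Ω] [m𝒳 : MeasurableSpace 𝒳] {μ : Measure Ω}

theorem lintegral_indicator_condLExp [IsFiniteMeasure μ] {X : Ω → 𝒳} (hX : Measurable X)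
    {s : Set 𝒳} (hs : MeasurableSet s) (f : Ω → ℝ≥0∞) :
    ∫⁻ ω, (X ⁻¹' s).indicator (condLExp (m𝒳.comap X) μ f) ω ∂μ =
      ∫⁻ ω, (X ⁻¹' s).indicator f ω ∂μ := by
  rw [lintegral_indicator (hX hs), lintegral_indicator (hX hs),
    setLIntegral_condLExp hX.comap_le μ f ⟨s, hs, rfl⟩]

theorem lintegral_indicator_add_indicator_condLExp [IsFiniteMeasure μ] {X : Ω → 𝒳}
    (hX : Measurable X) {s t : Set 𝒳} (hs : MeasurableSet s) (ht : MeasurableSet t)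
    {f g : Ω → ℝ≥0∞} (hf : Measurable f) :
    ∫⁻ ω, ((X ⁻¹' s).indicator (condLExp (m𝒳.comap X) μ f) ω +
        (X ⁻¹' t).indicator (condLExp (m𝒳.comap X) μ g) ω) ∂μ =
      ∫⁻ ω, ((X ⁻¹' s).indicator f ω + (X ⁻¹' t).indicator g ω) ∂μ := by
  rw [lintegral_add_left ((measurable_condLExp' _ μ f).indicator (hX hs)),
    lintegral_add_left (hf.indicator (hX hs)), lintegral_indicator_condLExp hX hs,
    lintegral_indicator_condLExp hX ht]

theorem lintegral_indicator_add_indicator_ne_top {s t : Set Ω} {f g : Ω → ℝ≥0∞} (hf : Measurable f)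
    (hf' : ∫⁻ ω, f ω ∂μ ≠ ⊤) (hg' : ∫⁻ ω, g ω ∂μ ≠ ⊤) :
    ∫⁻ ω, (s.indicator f ω + t.indicator g ω) ∂μ ≠ ⊤ := by
  refine ne_top_of_le_ne_top (ENNReal.add_ne_top.2 ⟨hf', hg'⟩) ?_
  rw [← lintegral_add_left hf]
  exact lintegral_mono fun ω =>
    add_le_add (Set.indicator_le_self _ _ _) (Set.indicator_le_self _ _ _)

theorem measurableSet_treatSet {δ δs : 𝒳 → ({0, 1} : Set ℝ)} (hδ : Measurable δ)
    (hδs : Measurable δs) : MeasurableSet (treatSet δ δs) :=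
  (measurableSet_eq_fun hδ.subtype_val measurable_const).inter
    (measurableSet_eq_fun hδs.subtype_val measurable_const)

/-- Together with `identifiedRegion_swap`, this reduces the lower end of the interval to the upper
end for the exchanged rules. At most one of the two terms is nonzero, so negation distributes even
at infinite values. -/
theorem lowerGain_eq_neg_upperGain (𝒴₁ 𝒴₀ : Ω → Set ℝ) (X : Ω → 𝒳)
    (δ δs : 𝒳 → ({0, 1} : Set ℝ)) :
    lowerGain μ 𝒴₁ 𝒴₀ X δ δs = fun ω => -upperGain μ 𝒴₁ 𝒴₀ X δs δ ω := by
  ext ω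
  unfold lowerGain upperGain
  rw [theta01_eq, theta01_eq]
  by_cases h : X ω ∈ treatSet δ δs
  · simp [theta10_of_mem h, theta10_of_notMem (notMem_treatSet_swap h)]
  · by_cases h' : X ω ∈ treatSet δs δ
    · simp [theta10_of_mem h', theta10_of_notMem h]
    · simp [theta10_of_notMem h', theta10_of_notMem h]

theorem identifiedRegion_swap {𝒴₁ 𝒴₀ : Ω → Set ℝ} {X : Ω → 𝒳}
    {δ δs : 𝒳 → ({0, 1} : Set ℝ)} {β : ℝ} (h : β ∈ identifiedRegion μ 𝒴₁ 𝒴₀ X δ δs) :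
    -β ∈ identifiedRegion μ 𝒴₁ 𝒴₀ X δs δ := by
  obtain ⟨Y, hY, hYi, rfl⟩ := h
  refine ⟨Y, hY, hYi, ?_⟩
  rw [← integral_neg]
  exact integral_congr_ae (ae_of_all _ fun ω => by ring)

/-- The factor `δ(X) - δ*(X)` is `X`-measurable and bounded by `1`, so it can be pulled into the
conditional expectation. -/
theorem integral_condExp_mul_sub [IsFiniteMeasure μ] {X : Ω → 𝒳} (hX : Measurable X)
    {δ δs : 𝒳 → ({0, 1} : Set ℝ)} (hδ : Measurable δ) (hδs : Measurable δs) {c : Ω → ℝ}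
    (hc : Integrable c μ) :
    Integrable (fun ω => c ω * ((δ (X ω) : ℝ) - δs (X ω))) μ ∧
    ∫ ω, (condExp (m𝒳.comap X) μ c) ω * ((δ (X ω) : ℝ) - δs (X ω)) ∂μ =
      ∫ ω, c ω * ((δ (X ω) : ℝ) - δs (X ω)) ∂μ := by
  set g : Ω → ℝ := fun ω => (δ (X ω) : ℝ) - δs (X ω) with hgdef
  have hg : StronglyMeasurable[m𝒳.comap X] g :=
    ((hδ.subtype_val.sub hδs.subtype_val).comp (comap_measurable X)).stronglyMeasurable
  have hbd : ∀ ω, ‖g ω‖ ≤ 1 := fun ω => by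
    have h1 : (δ (X ω) : ℝ) = 0 ∨ (δ (X ω) : ℝ) = 1 := (δ (X ω)).2
    have h2 : (δs (X ω) : ℝ) = 0 ∨ (δs (X ω) : ℝ) = 1 := (δs (X ω)).2
    simp only [hgdef]
    rcases h1 with h1 | h1 <;> rcases h2 with h2 | h2 <;> simp [h1, h2]
  have hcg : Integrable (c * g) μ :=
    hc.mul_bdd (c := 1) (hg.mono hX.comap_le).aestronglyMeasurable (ae_of_all _ hbd)
  refine ⟨hcg, ?_⟩
  have h := condExp_mul_of_stronglyMeasurable_right hg hcg hc
  calc ∫ ω, (condExp (m𝒳.comap X) μ c) ω * g ω ∂μ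
      = ∫ ω, (condExp (m𝒳.comap X) μ (c * g)) ω ∂μ := integral_congr_ae h.symm
    _ = ∫ ω, c ω * g ω ∂μ := integral_condExp hX.comap_le

variable {𝒴₁ 𝒴₀ : Ω → Set ℝ} {X : Ω → 𝒳} {δ δs : 𝒳 → ({0, 1} : Set ℝ)}

theorem integrable_sub_of_integrable {ξ : Ω → EuclideanSpace ℝ (Fin 2)} (hξ : Integrable ξ μ) :
    Integrable (fun ω => ξ ω 0 - ξ ω 1) μ :=
  ((EuclideanSpace.proj (𝕜 := ℝ) (0 : Fin 2)).integrable_comp hξ).sub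
    ((EuclideanSpace.proj (𝕜 := ℝ) (1 : Fin 2)).integrable_comp hξ)

theorem lintegral_neg_supportFun_ne_top
    (hint : IsIntegrableRandomSet μ fun ω => planeProd (𝒴₁ ω) (𝒴₀ ω)) :
    ∫⁻ ω, (-supportFun vStar (planeProd (𝒴₁ ω) (𝒴₀ ω))).toENNReal ∂μ ≠ ⊤ ∧
      ∫⁻ ω, (-supportFun (-vStar) (planeProd (𝒴₁ ω) (𝒴₀ ω))).toENNReal ∂μ ≠ ⊤ := by
  obtain ⟨ξ, hξ, hξi⟩ := hint.exists_integrable_selection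
  have hD := integrable_sub_of_integrable hξi
  refine ⟨lintegral_neg_ne_top_of_coe_le hD
    (hξ.mem_ae.mono fun ω hω => coe_sub_le_supportFun_vStar hω),
    lintegral_neg_ne_top_of_coe_le (u := fun ω => ξ ω 1 - ξ ω 0) ?_
    (hξ.mem_ae.mono fun ω hω => coe_sub_le_supportFun_neg_vStar hω)⟩
  simpa only [neg_sub] using hD.fun_neg

theorem measurable_pointwiseGain (hcl : IsRandomClosedSet fun ω => planeProd (𝒴₁ ω) (𝒴₀ ω))
    (hX : Measurable X) (hδ : Measurable δ) (hδs : Measurable δs) :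
    Measurable (pointwiseGain 𝒴₁ 𝒴₀ X δ δs) := by
  have hA := hX (measurableSet_treatSet hδ hδs)
  have hB := hX (measurableSet_treatSet hδs hδ)
  have hS := measurable_supportFun hcl vStar
  have hT := measurable_supportFun hcl (-vStar)
  exact ((hS.ereal_toENNReal.indicator hA).add
      (hT.ereal_toENNReal.indicator hB)).coe_ereal_ennreal.sub
    (((continuous_neg.measurable.comp hS).ereal_toENNReal.indicator hA).add
      ((continuous_neg.measurable.comp hT).ereal_toENNReal.indicator hB)).coe_ereal_ennreal

/-- Conditioning on the covariates does not change the expected gain. -/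
theorem hasExpectation_upperGain_and_expectation_eq [IsFiniteMeasure μ]
    (hint : IsIntegrableRandomSet μ fun ω => planeProd (𝒴₁ ω) (𝒴₀ ω))
    (hX : Measurable X) (hδ : Measurable δ) (hδs : Measurable δs) :
    HasExpectation μ (upperGain μ 𝒴₁ 𝒴₀ X δ δs) ∧
      expectation μ (upperGain μ 𝒴₁ 𝒴₀ X δ δs) =
        expectation μ (pointwiseGain 𝒴₁ 𝒴₀ X δ δs) := by
  have hA := measurableSet_treatSet hδ hδs
  have hB := measurableSet_treatSet hδs hδ
  have hS := measurable_supportFun hint.isRandomClosedSet vStar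
  have hT := measurable_supportFun hint.isRandomClosedSet (-vStar)
  have hS' : Measurable fun ω => (-supportFun vStar (planeProd (𝒴₁ ω) (𝒴₀ ω))).toENNReal :=
    (continuous_neg.measurable.comp hS).ereal_toENNReal
  have hT' : Measurable fun ω => (-supportFun (-vStar) (planeProd (𝒴₁ ω) (𝒴₀ ω))).toENNReal :=
    (continuous_neg.measurable.comp hT).ereal_toENNReal
  obtain ⟨hSfin, hTfin⟩ := lintegral_neg_supportFun_ne_top hint
  have hfin := lintegral_indicator_add_indicator_ne_top (s := X ⁻¹' treatSet δ δs)
    (t := X ⁻¹' treatSet δs δ) hS' hSfin hTfin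
  -- Where `δ = 0` and `δ* = 1`, the two minus signs around `E[s(-v*, ·) | X]` cancel. The indicator
  -- sets are `X`-measurable, so each term keeps its integral when the conditioning is removed.
  have hup : upperGain μ 𝒴₁ 𝒴₀ X δ δs = fun ω =>
      (((X ⁻¹' treatSet δ δs).indicator (condLExp (m𝒳.comap X) μ
          fun ω => (supportFun vStar (planeProd (𝒴₁ ω) (𝒴₀ ω))).toENNReal) ω +
        (X ⁻¹' treatSet δs δ).indicator (condLExp (m𝒳.comap X) μ
          fun ω => (supportFun (-vStar) (planeProd (𝒴₁ ω) (𝒴₀ ω))).toENNReal) ω : ℝ≥0∞) : EReal) -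
      (((X ⁻¹' treatSet δ δs).indicator (condLExp (m𝒳.comap X) μ
          fun ω => (-supportFun vStar (planeProd (𝒴₁ ω) (𝒴₀ ω))).toENNReal) ω +
        (X ⁻¹' treatSet δs δ).indicator (condLExp (m𝒳.comap X) μ
          fun ω => (-supportFun (-vStar) (planeProd (𝒴₁ ω) (𝒴₀ ω))).toENNReal) ω : ℝ≥0∞) :
            EReal) := by
    ext ω
    unfold upperGain cateUpper cateLower condExpectation
    rw [theta01_eq]
    by_cases h : X ω ∈ treatSet δ δs
    · simp [theta10_of_mem h, theta10_of_notMem (notMem_treatSet_swap h), h,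
        notMem_treatSet_swap h]
    · by_cases h' : X ω ∈ treatSet δs δ
      · simp [theta10_of_mem h', theta10_of_notMem h, h, h']
      · simp [theta10_of_notMem h', theta10_of_notMem h, h, h']
  have hmeas : ∀ f g : Ω → ℝ≥0∞, Measurable fun ω =>
      (X ⁻¹' treatSet δ δs).indicator (condLExp (m𝒳.comap X) μ f) ω +
        (X ⁻¹' treatSet δs δ).indicator (condLExp (m𝒳.comap X) μ g) ω := fun f g =>
    ((measurable_condLExp' _ μ f).indicator (hX hA)).add
      ((measurable_condLExp' _ μ g).indicator (hX hB))
  have hfin' := hfin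
  rw [← lintegral_indicator_add_indicator_condLExp hX hA hB hS'] at hfin'
  rw [hup]
  refine ⟨hasExpectation_sub (hmeas _ _) (hmeas _ _) hfin', ?_⟩
  rw [expectation_sub (hmeas _ _) (hmeas _ _) hfin',
    lintegral_indicator_add_indicator_condLExp hX hA hB hS',
    lintegral_indicator_add_indicator_condLExp hX hA hB hS.ereal_toENNReal]
  exact (expectation_sub
    ((hS.ereal_toENNReal.indicator (hX hA)).add (hT.ereal_toENNReal.indicator (hX hB)))
    ((hS'.indicator (hX hA)).add (hT'.indicator (hX hB))) hfin).symm

theorem le_expectation_upperGain [IsFiniteMeasure μ]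
    (hint : IsIntegrableRandomSet μ fun ω => planeProd (𝒴₁ ω) (𝒴₀ ω))
    (hX : Measurable X) (hδ : Measurable δ) (hδs : Measurable δs) {β : ℝ}
    (hβ : β ∈ identifiedRegion μ 𝒴₁ 𝒴₀ X δ δs) :
    (β : EReal) ≤ expectation μ (upperGain μ 𝒴₁ 𝒴₀ X δ δs) := by
  obtain ⟨Y, hY, hYi, rfl⟩ := hβ
  obtain ⟨hi, he⟩ := integral_condExp_mul_sub hX hδ hδs hYi
  rw [he, (hasExpectation_upperGain_and_expectation_eq hint hX hδ hδs).2, ← expectation_coe hi]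
  exact expectation_mono_ae (hY.mem_ae.mono fun ω hω => coe_mul_le_pointwiseGain hω)

/-- This is the sharpness half: from an attained value, every real number up to the upper bound is
reached. -/
theorem mem_identifiedRegion_of_le [IsFiniteMeasure μ]
    (hint : IsIntegrableRandomSet μ fun ω => planeProd (𝒴₁ ω) (𝒴₀ ω))
    (hconv : ∀ᵐ ω ∂μ, Convex ℝ (planeProd (𝒴₁ ω) (𝒴₀ ω)))
    (hX : Measurable X) (hδ : Measurable δ) (hδs : Measurable δs) {β₀ β : ℝ}
    (hβ₀ : β₀ ∈ identifiedRegion μ 𝒴₁ 𝒴₀ X δ δs) (hle : β₀ ≤ β)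
    (hβ : (β : EReal) ≤ expectation μ (upperGain μ 𝒴₁ 𝒴₀ X δ δs)) :
    β ∈ identifiedRegion μ 𝒴₁ 𝒴₀ X δ δs := by
  obtain ⟨Y, hY, hYi, rfl⟩ := hβ₀
  obtain ⟨hi, he⟩ := integral_condExp_mul_sub hX hδ hδs hYi
  rw [he] at hle
  rw [(hasExpectation_upperGain_and_expectation_eq hint hX hδ hδs).2] at hβ
  have hgm : Measurable fun ω => (δ (X ω) : ℝ) - δs (X ω) :=
    (hδ.subtype_val.sub hδs.subtype_val).comp hX
  have hDm : Measurable fun ω => Y ω 0 - Y ω 1 := by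
    have := hY.measurable
    fun_prop
  obtain ⟨h, hhm, hhi, hlow, hhigh, hhβ⟩ := exists_integrable_between
    (h₀ := fun ω => (Y ω 0 - Y ω 1) * ((δ (X ω) : ℝ) - δs (X ω)))
    (measurable_pointwiseGain hint.isRandomClosedSet hX hδ hδs) (hDm.mul hgm) hi
    (hY.mem_ae.mono fun ω hω => coe_mul_le_pointwiseGain hω) hle hβ
  -- Write `D` for the difference of `Y` and `g` for that of the rules. Where `g = ±1`, `g² = 1`
  -- gives `c = h g`; where `g = 0`, `c = D`. In the direction of `g` the bound on `c` comes from `h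
  -- ≤ G`, in the opposite one from `D g ≤ h`. Where `g = 0`, both `D g` and `G` vanish, forcing `h
  -- = 0 = c g`.
  set c : Ω → ℝ := fun ω => (Y ω 0 - Y ω 1) +
    (h ω - (Y ω 0 - Y ω 1) * ((δ (X ω) : ℝ) - δs (X ω))) * ((δ (X ω) : ℝ) - δs (X ω)) with hcdef
  have hcm : Measurable c := hDm.add ((hhm.sub (hDm.mul hgm)).mul hgm)
  have hci : Integrable c μ := hYi.add (integral_condExp_mul_sub hX hδ hδs (hhi.sub hi)).1
  have hc : ∀ᵐ ω ∂μ, (c ω : EReal) ≤ supportFun vStar (planeProd (𝒴₁ ω) (𝒴₀ ω)) ∧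
      ((-c ω : ℝ) : EReal) ≤ supportFun (-vStar) (planeProd (𝒴₁ ω) (𝒴₀ ω)) ∧
      c ω * ((δ (X ω) : ℝ) - δs (X ω)) = h ω := by
    filter_upwards [hY.mem_ae, hhigh] with ω hω hhω
    have hlω : (Y ω 0 - Y ω 1) * ((δ (X ω) : ℝ) - δs (X ω)) ≤ h ω := hlow ω
    have h1 := coe_sub_le_supportFun_vStar hω
    have h2 := coe_sub_le_supportFun_neg_vStar hω
    by_cases hA : X ω ∈ treatSet δ δs
    · rw [pointwiseGain_of_mem hA] at hhω
      rw [hA.1, hA.2] at hlω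
      have hcω : c ω = h ω := by simp only [hcdef, hA.1, hA.2]; ring
      rw [hcω, hA.1, hA.2]
      refine ⟨hhω, (EReal.coe_le_coe_iff.2 ?_).trans h2, by ring⟩
      linarith
    by_cases hB : X ω ∈ treatSet δs δ
    · rw [pointwiseGain_of_mem_swap hB] at hhω
      rw [hB.1, hB.2] at hlω
      have hcω : c ω = -h ω := by simp only [hcdef, hB.1, hB.2]; ring
      rw [hcω, hB.1, hB.2, neg_neg]
      refine ⟨(EReal.coe_le_coe_iff.2 ?_).trans h1, hhω, by ring⟩
      linarith
    · rw [pointwiseGain_of_notMem hA hB] at hhω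
      have hg := eq_of_notMem_treatSet hA hB
      rw [hg, sub_self, mul_zero] at hlω
      have hh0 : h ω ≤ 0 := by exact_mod_cast hhω
      have hcω : c ω = Y ω 0 - Y ω 1 := by simp only [hcdef, hg]; ring
      rw [hcω, hg, neg_sub]
      exact ⟨h1, h2, by linarith⟩
  obtain ⟨Z, hZ, hZc⟩ := exists_isSelection_sub_eq hint.isRandomClosedSet hconv hY hcm
    (hc.mono fun ω hω => hω.1) (hc.mono fun ω hω => hω.2.1)
  refine ⟨Z, hZ, by simpa only [hZc] using hci, ?_⟩
  simp only [hZc]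
  rw [← hhβ, (integral_condExp_mul_sub hX hδ hδs hci).2]
  exact integral_congr_ae (hc.mono fun ω hω => hω.2.2.symm)

end Gain

end WelfareGain

theorem theorem1 {Ω 𝒳 : Type*} [MeasurableSpace Ω] [MeasurableSpace 𝒳]
    (μ : Measure Ω) [IsProbabilityMeasure μ]
    (X : Ω → 𝒳) (hX : Measurable X)
    (𝒴₁ 𝒴₀ : Ω → Set ℝ)
    (hint : WelfareGain.IsIntegrableRandomSet μ (fun ω => WelfareGain.planeProd (𝒴₁ ω) (𝒴₀ ω)))
    (hconv : ∀ᵐ ω ∂μ, Convex ℝ (WelfareGain.planeProd (𝒴₁ ω) (𝒴₀ ω)))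
    (δ δs : 𝒳 → ({0, 1} : Set ℝ)) (hδ : Measurable δ) (hδs : Measurable δs) :
    -- all extended-valued expectations below exist
    (WelfareGain.HasExpectation μ (fun ω =>
        WelfareGain.supportFun WelfareGain.vStar (WelfareGain.planeProd (𝒴₁ ω) (𝒴₀ ω))) ∧
      WelfareGain.HasExpectation μ (fun ω =>
        WelfareGain.supportFun (-WelfareGain.vStar) (WelfareGain.planeProd (𝒴₁ ω) (𝒴₀ ω))) ∧
      WelfareGain.HasExpectation μ (WelfareGain.lowerGain μ 𝒴₁ 𝒴₀ X δ δs) ∧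
      WelfareGain.HasExpectation μ (WelfareGain.upperGain μ 𝒴₁ 𝒴₀ X δ δs)) ∧
    -- the identified region is the (nonempty) interval `[β_l, β_u]`
    (WelfareGain.identifiedRegion μ 𝒴₁ 𝒴₀ X δ δs).Nonempty ∧
    WelfareGain.identifiedRegion μ 𝒴₁ 𝒴₀ X δ δs =
      {β : ℝ | WelfareGain.expectation μ (WelfareGain.lowerGain μ 𝒴₁ 𝒴₀ X δ δs) ≤ (β : EReal) ∧
        (β : EReal) ≤ WelfareGain.expectation μ (WelfareGain.upperGain μ 𝒴₁ 𝒴₀ X δ δs)} := by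
  have hsupp := WelfareGain.lintegral_neg_supportFun_ne_top hint
  have hup := WelfareGain.hasExpectation_upperGain_and_expectation_eq hint hX hδ hδs
  have hup' := WelfareGain.hasExpectation_upperGain_and_expectation_eq hint hX hδs hδ
  have hlow : WelfareGain.expectation μ (WelfareGain.lowerGain μ 𝒴₁ 𝒴₀ X δ δs) =
      -WelfareGain.expectation μ (WelfareGain.upperGain μ 𝒴₁ 𝒴₀ X δs δ) := by
    rw [WelfareGain.lowerGain_eq_neg_upperGain, hup'.1.expectation_neg]
  obtain ⟨ξ, hξ, hξi⟩ := hint.exists_integrable_selection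
  have hmem : ∫ ω, (condExp (MeasurableSpace.comap X inferInstance) μ fun ω => ξ ω 0 - ξ ω 1) ω *
      ((δ (X ω) : ℝ) - δs (X ω)) ∂μ ∈ WelfareGain.identifiedRegion μ 𝒴₁ 𝒴₀ X δ δs :=
    ⟨ξ, hξ, WelfareGain.integrable_sub_of_integrable hξi, rfl⟩
  have hmeas := WelfareGain.measurable_supportFun hint.isRandomClosedSet
  refine ⟨⟨⟨(hmeas _).aemeasurable, Or.inr hsupp.1⟩, ⟨(hmeas _).aemeasurable, Or.inr hsupp.2⟩,
    by rw [WelfareGain.lowerGain_eq_neg_upperGain]; exact hup'.1.neg, hup.1⟩, ⟨_, hmem⟩, ?_⟩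
  rw [hlow]
  ext β
  constructor
  · intro hβ
    refine ⟨?_, WelfareGain.le_expectation_upperGain hint hX hδ hδs hβ⟩
    rw [EReal.neg_le, ← EReal.coe_neg]
    exact WelfareGain.le_expectation_upperGain hint hX hδs hδ (WelfareGain.identifiedRegion_swap hβ)
  · rintro ⟨h1, h2⟩
    -- The value attained by `ξ` splits the interval. Points above it are reached directly, points
    -- below it by exchanging the rules and negating.
    rcases le_total (∫ ω, (condExp (MeasurableSpace.comap X inferInstance) μ
        fun ω => ξ ω 0 - ξ ω 1) ω * ((δ (X ω) : ℝ) - δs (X ω)) ∂μ) β with hle | hle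
    · exact WelfareGain.mem_identifiedRegion_of_le hint hconv hX hδ hδs hmem hle h2
    · rw [EReal.neg_le, ← EReal.coe_neg] at h1
      have := WelfareGain.mem_identifiedRegion_of_le hint hconv hX hδs hδ
        (WelfareGain.identifiedRegion_swap hmem) (neg_le_neg hle) h1
      simpa using WelfareGain.identifiedRegion_swap this
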